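/- All Banach spaces are real. Let $K$ be a compact Hausdorff space together with a lower semicontinuous metric $d$ on $K$, that is, a metric $d:K\times K\to[0,\infty)$ that is lower semicontinuous for the product topology of $K\times K$. Let $C(K)$ be the space of real functions on $K$ that are continuous for the compact topology, with the supremum norm; a function or map is called Lipschitz if it is Lipschitz for the metric(s) $d$. We say that $C(K)$ is isometrically (resp. isomorphically) Lipschitz universal for the separable Banach spaces if for every separable Banach space $X$ there is a linear isometric (resp. isomorphic, i.e. bounded linear and bounded below) embedding $J:X\to C(K)$ such that $J(x)$ is a Lipschitz function for every $x\in X$. Let $\Delta=\{0,1\}^{\mathbb N}$ be the Cantor space with its product topology, together with the discrete metric (distance $1$ between distinct points). Then $C(\Delta)$ is isometrically Lipschitz universal for the separable Banach spaces. Conversely, if $K$ is a metrizable compact space with a lower semicontinuous metric $d$ such that $C(K)$ is isomorphically Lipschitz universal for the separable Banach spaces, then there is a subset $H\subset K$ equivalent to $\Delta$: there is a bijection $\varphi:H\to\Delta$ that is a homeomorphism for the topologies and such that both $\varphi$ and $\varphi^{-1}$ are Lipschitz, where $H$ carries the topology of $K$ and the restriction of $d$ and $\Delta$ carries the product topology and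 the discrete metric. -/

import Mathlib

universe u v

/-- A lower semicontinuous metric on a topological space `K`: a metric `d : K × K → [0, ∞)`, in
general unrelated to the topology of `K` otherwise, which is lower semicontinuous on `K × K` for the
product of the given topology. (Non-negativity follows from the other axioms.) -/
structure LscMetric (K : Type*) [TopologicalSpace K] where
  /-- the distance function -/
  d : K → K → ℝ
  d_self : ∀ x, d x x = 0
  eq_of_d_eq_zero : ∀ x y, d x y = 0 → x = y
  d_comm : ∀ x y, d x y = d y x
  d_triangle : ∀ x y z, d x z ≤ d x y + d y z
  lsc : LowerSemicontinuous fun p : K × K => d p.1 p.2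

namespace LscMetric

/-- The discrete metric, taking the value `1` at all pairs of distinct points. -/
noncomputable def discrete (K : Type*) [TopologicalSpace K] [T2Space K] : LscMetric K where
  d x y := open Classical in if x = y then 0 else 1
  d_self x := by simp
  eq_of_d_eq_zero x y h := by
    by_contra hne
    simp [hne] at h
  d_comm x y := by
    by_cases h : x = y
    · rw [h]
    · rw [if_neg h, if_neg (Ne.symm h)]
  d_triangle x y z := by
    by_cases h₁ : x = y
    · subst h₁
      simp
    · have h₂ : (0 : ℝ) ≤ (open Classical in if y = z then (0 : ℝ) else 1) := by
        split_ifs <;> norm_num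
      have h₃ : (open Classical in if x = z then (0 : ℝ) else 1) ≤ 1 := by
        split_ifs <;> norm_num
      rw [if_neg h₁]
      linarith
  lsc := by
    intro p c hc
    by_cases h : p.1 = p.2
    · refine Filter.Eventually.of_forall fun q => ?_
      have hc' : c < 0 := by simpa only [if_pos h] using hc
      change c < (open Classical in if q.1 = q.2 then (0 : ℝ) else 1)
      split_ifs <;> linarith
    · simp only [if_neg h] at hc
      have ho : IsOpen {q : K × K | q.1 ≠ q.2} := isOpen_ne_fun continuous_fst continuous_snd
      filter_upwards [ho.mem_nhds h] with q hq
      simpa only [if_neg hq] using hc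

/-- The restriction of a lower semicontinuous metric to a subset with the subspace topology. -/
def restrict {K : Type*} [TopologicalSpace K] (m : LscMetric K) (H : Set K) : LscMetric H where
  d x y := m.d x y
  d_self x := m.d_self x
  eq_of_d_eq_zero x y h := Subtype.ext (m.eq_of_d_eq_zero x y h)
  d_comm x y := m.d_comm x y
  d_triangle x y z := m.d_triangle x y z
  lsc := m.lsc.comp (g := fun p : H × H => ((p.1 : K), (p.2 : K))) (by fun_prop)

/-- A real function is Lipschitz with respect to `m` (its Lipschitz constant is finite). -/
def IsLipschitzFun {K : Type*} [TopologicalSpace K] (m : LscMetric K) (f : K → ℝ) : Prop :=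
  ∃ L : ℝ, ∀ s t, |f s - f t| ≤ L * m.d s t

/-- A map between two spaces is Lipschitz with respect to the given metrics. -/
def IsLipschitzMap {K₁ K₂ : Type*} [TopologicalSpace K₁] [TopologicalSpace K₂]
    (m₁ : LscMetric K₁) (m₂ : LscMetric K₂) (φ : K₁ → K₂) : Prop :=
  ∃ L : ℝ, ∀ s t, m₂.d (φ s) (φ t) ≤ L * m₁.d s t

/-- Equivalence of spaces with lower semicontinuous metrics: there is a bijection which is at the
same time a homeomorphism for the topologies and a Lipschitz isomorphism for the metrics. -/
def Equivalent {K₁ K₂ : Type*} [TopologicalSpace K₁] [TopologicalSpace K₂]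
    (m₁ : LscMetric K₁) (m₂ : LscMetric K₂) : Prop :=
  ∃ φ : K₁ ≃ₜ K₂, IsLipschitzMap m₁ m₂ φ ∧ IsLipschitzMap m₂ m₁ φ.symm

/-- `C(K)` (continuity for the topology of `K`, supremum norm) contains a linearly isometric copy of
`X` consisting of functions that are Lipschitz for the metric. -/
def ContainsIsometricLipschitzCopy {K : Type*} [TopologicalSpace K] [CompactSpace K]
    (m : LscMetric K) (X : Type*) [NormedAddCommGroup X] [NormedSpace ℝ X] : Prop :=
  ∃ J : X →ₗᵢ[ℝ] C(K, ℝ), ∀ x : X, m.IsLipschitzFun (J x)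

/-- `C(K)` (continuity for the topology of `K`, supremum norm) contains a linearly isomorphic copy of
`X` consisting of functions that are Lipschitz for the metric. -/
def ContainsIsomorphicLipschitzCopy {K : Type*} [TopologicalSpace K] [CompactSpace K]
    (m : LscMetric K) (X : Type*) [NormedAddCommGroup X] [NormedSpace ℝ X] : Prop :=
  ∃ J : X →L[ℝ] C(K, ℝ),
    (∃ c : ℝ, 0 < c ∧ ∀ x : X, c * ‖x‖ ≤ ‖J x‖) ∧ ∀ x : X, m.IsLipschitzFun (J x)

/-- `C(K)` is isometrically Lipschitz universal for the separable (real) Banach spaces. -/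
def IsometricLipschitzUniversal {K : Type v} [TopologicalSpace K] [CompactSpace K]
    (m : LscMetric K) : Prop :=
  ∀ (X : Type u) [NormedAddCommGroup X] [NormedSpace ℝ X] [CompleteSpace X]
    [TopologicalSpace.SeparableSpace X], m.ContainsIsometricLipschitzCopy X

/-- `C(K)` is isomorphically Lipschitz universal for the separable (real) Banach spaces. -/
def IsomorphicLipschitzUniversal {K : Type v} [TopologicalSpace K] [CompactSpace K]
    (m : LscMetric K) : Prop :=
  ∀ (X : Type u) [NormedAddCommGroup X] [NormedSpace ℝ X] [CompleteSpace X]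
    [TopologicalSpace.SeparableSpace X], m.ContainsIsomorphicLipschitzCopy X

end LscMetric

/-- The Cantor space `{0,1}^ℕ`, with the product topology. -/
abbrev CantorSpace : Type := ℕ → Bool

/-- The discrete metric on the Cantor space. -/
noncomputable abbrev cantorMetric : LscMetric CantorSpace := LscMetric.discrete CantorSpace

/-!
Let `J` embed `C(X)` into `C(K)` with `c * ‖f‖ ≤ ‖J f‖` and write `ν t = J* δ_t`, a measure on `X`.
Every `s : X` is an atom of mass at least `c / 2` of some `ν t`: otherwise, by compactness of `K`,
tent functions at `s` can be grouped in consecutive blocks along each of which every `ν t` drops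
below `c / 2`, and the mean of one tent per block has norm `1` but an image of norm less than `c`.
Since a measure has finitely many atoms of given mass, uncountably many `t` result for which each
`ν t` is within `c / 4` of only finitely many others. As `‖ν t - ν t'‖` is lower semicontinuous in
`(t, t')`, a Cantor scheme of condensation points yields a Cantor set on which the `ν t` are
`c / 4`-separated; by the uniform boundedness principle `ν` is Lipschitz, so this set is separated
for the metric of `K` too.

The embedding of `X` into `C(Δ)` is the Banach–Mazur theorem: `Δ` maps onto the dual unit ball.
-/

open Set Filter Topology TopologicalSpace

section CantorScheme

theorem countable_inter_of_locally {α : Type*} [TopologicalSpace α] [HereditarilyLindelofSpace α]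
    {A B : Set α} (h : ∀ x ∈ B, ∃ U ∈ 𝓝 x, (A ∩ U).Countable) : (A ∩ B).Countable := by
  refine (HereditarilyLindelofSpace.isLindelof B).induction_on (p := fun S => (A ∩ S).Countable)
    (fun S T hST hT => hT.mono (inter_subset_inter_right A hST)) (fun 𝒮 h𝒮 hA => ?_)
    (fun x hx => ?_)
  · rw [sUnion_eq_biUnion, inter_iUnion₂]
    exact h𝒮.biUnion hA
  · obtain ⟨U, hU, hAU⟩ := h x hx
    exact ⟨U, mem_nhdsWithin_of_mem_nhds hU, hAU⟩

theorem exists_ediam_le_of_mem_nhds {α : Type*} [PseudoEMetricSpace α] {x : α} {U : Set α}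
    (hU : U ∈ 𝓝 x) {ε : ENNReal} (hε : 0 < ε) :
    ∃ D ∈ 𝓝 x, closure D ⊆ U ∧ Metric.ediam D ≤ ε := by
  have hball : Metric.eball x (ε / 2) ∈ 𝓝 x :=
    Metric.eball_mem_nhds x (ENNReal.half_pos hε.ne')
  obtain ⟨D, hD, hDclosed, hDU⟩ := exists_mem_nhds_isClosed_subset (inter_mem hU hball)
  refine ⟨D, hD, hDclosed.closure_eq.subset.trans (hDU.trans inter_subset_left), ?_⟩
  calc Metric.ediam D ≤ Metric.ediam (Metric.eball x (ε / 2)) :=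
        Metric.ediam_mono (hDU.trans inter_subset_right)
    _ ≤ 2 * (ε / 2) := Metric.ediam_eball_le
    _ = ε := ENNReal.mul_div_cancel two_ne_zero ENNReal.ofNat_ne_top

variable {α : Type*} {R : α → α → Prop} {A : Set α}

theorem exists_related_condensation_points [TopologicalSpace α] [HereditarilyLindelofSpace α]
    (hA : ¬ A.Countable) (hAR : ∀ a ∈ A, {b ∈ A | ¬ R a b}.Countable) :
    ∃ x y, R x y ∧ (∀ U ∈ 𝓝 x, ¬ (A ∩ U).Countable) ∧ ∀ U ∈ 𝓝 y, ¬ (A ∩ U).Countable := by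
  let G : Set α := {x ∈ A | ∀ U ∈ 𝓝 x, ¬ (A ∩ U).Countable}
  have hG : ¬ G.Countable := by
    intro hG
    have hrest : (A ∩ (A \ G)).Countable := by
      refine countable_inter_of_locally fun x hx => ?_
      by_contra! h
      exact hx.2 ⟨hx.1, h⟩
    refine hA ((hG.union hrest).mono fun x hx => ?_)
    by_cases hxG : x ∈ G
    · exact Or.inl hxG
    · exact Or.inr ⟨hx, hx, hxG⟩
  obtain ⟨x, hxA, hx⟩ : G.Nonempty := nonempty_iff_ne_empty.2 fun h => hG (h ▸ countable_empty)
  obtain ⟨y, hy, hxy⟩ : ∃ y ∈ G, R x y := by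
    by_contra! h
    exact hG ((hAR x hxA).mono fun y hy => And.intro hy.1 (h y hy))
  exact ⟨x, y, hxy, hx, hy.2⟩

theorem exists_uncountable_splitting [PseudoEMetricSpace α] [SecondCountableTopology α]
    (hR : IsOpen {p : α × α | R p.1 p.2}) (hA : ¬ A.Countable)
    (hAR : ∀ a ∈ A, {b ∈ A | ¬ R a b}.Countable) {ε : ENNReal} (hε : 0 < ε) :
    ∃ B : Bool → Set α, (∀ i, B i ⊆ A ∧ ¬ (B i).Countable ∧ Metric.ediam (B i) ≤ ε) ∧
      ∀ x ∈ closure (B false), ∀ y ∈ closure (B true), R x y := by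
  obtain ⟨x, y, hxy, hx, hy⟩ := exists_related_condensation_points hA hAR
  obtain ⟨U, hU, V, hV, hUV⟩ := mem_nhds_prod_iff.1 (hR.mem_nhds hxy)
  obtain ⟨D, hD, hDU, hDε⟩ := exists_ediam_le_of_mem_nhds hU hε
  obtain ⟨E, hE, hEV, hEε⟩ := exists_ediam_le_of_mem_nhds hV hε
  refine ⟨fun i => A ∩ cond i E D, Bool.forall_bool.2
    ⟨⟨inter_subset_left, hx D hD, (Metric.ediam_mono inter_subset_right).trans hDε⟩,
      inter_subset_left, hy E hE, (Metric.ediam_mono inter_subset_right).trans hEε⟩, ?_⟩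
  intro x' hx' y' hy'
  exact hUV (mk_mem_prod (hDU (closure_mono inter_subset_right hx'))
    (hEV (closure_mono inter_subset_right hy')))

theorem exists_uncountable_scheme [PseudoEMetricSpace α] [SecondCountableTopology α]
    (hR : IsOpen {p : α × α | R p.1 p.2}) (hA : ¬ A.Countable)
    (hAR : ∀ a ∈ A, {b ∈ A | ¬ R a b}.Countable) {ε : ℕ → ENNReal} (hε : ∀ n, 0 < ε n) :
    ∃ B : List Bool → Set α, (∀ l, B l ⊆ A ∧ ¬ (B l).Countable) ∧
      (∀ l i, B (i :: l) ⊆ B l ∧ Metric.ediam (B (i :: l)) ≤ ε l.length) ∧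
      ∀ l, ∀ x ∈ closure (B (false :: l)), ∀ y ∈ closure (B (true :: l)), R x y := by
  let P := {B : Set α // B ⊆ A ∧ ¬ B.Countable}
  have split (B : P) (n : ℕ) : ∃ F : Bool → P,
      (∀ i, (F i).1 ⊆ B.1 ∧ Metric.ediam (F i).1 ≤ ε n) ∧
      ∀ x ∈ closure (F false).1, ∀ y ∈ closure (F true).1, R x y := by
    obtain ⟨F, hF, hFR⟩ := exists_uncountable_splitting hR B.2.2
      (fun a ha => (hAR a (B.2.1 ha)).mono fun b => And.imp_left (B.2.1 ·)) (hε n)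
    exact ⟨fun i => ⟨F i, (hF i).1.trans B.2.1, (hF i).2.1⟩, fun i => ⟨(hF i).1, (hF i).2.2⟩, hFR⟩
  choose F hF hFR using split
  let B : List Bool → P := List.rec ⟨A, Subset.rfl, hA⟩ fun i l E => F E l.length i
  exact ⟨fun l => (B l).1, fun l => (B l).2, fun l i => hF (B l) l.length i,
    fun l => hFR (B l) l.length⟩

theorem exists_continuous_mem_scheme [PseudoMetricSpace α] [CompleteSpace α] {β : Type*}
    [TopologicalSpace β] [DiscreteTopology β] {D : List β → Set α}
    (hdiam : CantorScheme.VanishingDiam D) (hanti : CantorScheme.ClosureAntitone D)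
    (hne : ∀ l, (D l).Nonempty) :
    ∃ f : (ℕ → β) → α, Continuous f ∧ ∀ x n, f x ∈ D (PiNat.res x n) := by
  have hdom (x : ℕ → β) : x ∈ (CantorScheme.inducedMap D).1 :=
    hanti.map_of_vanishingDiam hdiam hne ▸ mem_univ x
  exact ⟨fun x => (CantorScheme.inducedMap D).2 ⟨x, hdom x⟩,
    hdiam.map_continuous.comp (by fun_prop), fun x n => CantorScheme.map_mem ⟨x, hdom x⟩ n⟩

theorem pairwise_of_mem_scheme {D : List Bool → Set α} {f : (ℕ → Bool) → α}
    (hf : ∀ x n, f x ∈ D (PiNat.res x n)) [Std.Symm R]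
    (hDR : ∀ l, ∀ x ∈ D (false :: l), ∀ y ∈ D (true :: l), R x y) :
    Pairwise fun x y => R (f x) (f y) := by
  intro x y hxy
  set n := PiNat.firstDiff x y
  have hres : PiNat.res x n = PiNat.res y n :=
    PiNat.res_eq_res.2 fun _ => PiNat.apply_eq_of_lt_firstDiff
  have hx : f x ∈ D (x n :: PiNat.res x n) := hf x (n + 1)
  have hy : f y ∈ D (y n :: PiNat.res x n) := hres ▸ hf y (n + 1)
  have hne : x n ≠ y n := PiNat.apply_firstDiff_ne hxy
  cases hxn : x n <;> cases hyn : y n <;> rw [hxn] at hx <;> rw [hyn] at hy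
  · exact absurd (hxn.trans hyn.symm) hne
  · exact hDR _ _ hx _ hy
  · exact symm_of R (hDR _ _ hy _ hx)
  · exact absurd (hxn.trans hyn.symm) hne

theorem exists_continuous_cantor_pairwise [PseudoMetricSpace α] [CompleteSpace α]
    [SecondCountableTopology α] (hR : IsOpen {p : α × α | R p.1 p.2}) [Std.Symm R]
    (hA : ¬ A.Countable) (hAR : ∀ a ∈ A, {b ∈ A | ¬ R a b}.Countable) :
    ∃ f : (ℕ → Bool) → α, Continuous f ∧ (∀ x, f x ∈ closure A) ∧
      Pairwise fun x y => R (f x) (f y) := by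
  obtain ⟨ε, -, hε, hε0⟩ := exists_seq_strictAnti_tendsto' (zero_lt_one' ENNReal)
  obtain ⟨B, hBA, hB, hBR⟩ := exists_uncountable_scheme hR hA hAR fun n => (hε n).1
  have hanti : CantorScheme.ClosureAntitone fun l => closure (B l) :=
    CantorScheme.Antitone.closureAntitone (fun l i => closure_mono (hB l i).1)
      fun _ => isClosed_closure
  have hdiam : CantorScheme.VanishingDiam fun l => closure (B l) := by
    intro x
    rw [← tendsto_add_atTop_iff_nat 1]
    refine tendsto_of_tendsto_of_tendsto_of_le_of_le tendsto_const_nhds hε0 (fun _ => zero_le)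
      fun n => ?_
    simpa only [PiNat.res_succ, PiNat.res_length, Metric.ediam_closure]
      using (hB (PiNat.res x n) (x n)).2
  have hne (l : List Bool) : (closure (B l)).Nonempty :=
    Nonempty.closure (nonempty_iff_ne_empty.2 fun h => (hBA l).2 (h ▸ countable_empty))
  obtain ⟨f, hf, hfB⟩ := exists_continuous_mem_scheme hdiam hanti hne
  exact ⟨f, hf, fun x => closure_mono (hBA []).1 (hfB x 0),
    pairwise_of_mem_scheme (D := fun l => closure (B l)) hfB hBR⟩

end CantorScheme

section Atoms

theorem sum_abs_apply_le_norm_mul {X ι : Type*} [TopologicalSpace X] [CompactSpace X]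
    (ν : C(X, ℝ) →L[ℝ] ℝ) (T : Finset ι) (g : ι → C(X, ℝ)) :
    ∑ i ∈ T, |ν (g i)| ≤ ‖ν‖ * ‖∑ i ∈ T, |g i|‖ := by
  let f : C(X, ℝ) := ∑ i ∈ T, (SignType.sign (ν (g i)) : ℝ) • g i
  have hf : ‖f‖ ≤ ‖∑ i ∈ T, |g i|‖ := by
    refine (ContinuousMap.norm_le _ (norm_nonneg _)).2 fun x => ?_
    calc ‖f x‖ = ‖∑ i ∈ T, (SignType.sign (ν (g i)) : ℝ) * g i x‖ := by
          simp [f, ContinuousMap.sum_apply]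
      _ ≤ ∑ i ∈ T, |g i x| := by
          refine norm_sum_le_of_le T fun i _ => ?_
          rw [norm_mul]
          refine mul_le_of_le_one_left (norm_nonneg _) ?_
          generalize SignType.sign (ν (g i)) = a
          cases a <;> simp
      _ = (∑ i ∈ T, |g i|) x := by simp [ContinuousMap.sum_apply]
      _ ≤ ‖∑ i ∈ T, |g i|‖ :=
          (le_abs_self _).trans (ContinuousMap.norm_coe_le_norm (∑ i ∈ T, |g i|) x)
  calc ∑ i ∈ T, |ν (g i)| = ν f := by simp [f, map_sum, sign_mul_self]
    _ ≤ ‖ν‖ * ‖f‖ := (le_abs_self _).trans (ν.le_opNorm f)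
    _ ≤ ‖ν‖ * ‖∑ i ∈ T, |g i|‖ := by gcongr

section Tent

variable {X : Type*} [PseudoMetricSpace X]

/-- The tent function of height `1` at `s`, vanishing at distance `1 / n` from `s` (constant for
`n = 0`). -/
def tent (s : X) (n : ℕ) : C(X, ℝ) where
  toFun x := max 0 (1 - n * dist x s)

theorem tent_apply (s : X) (n : ℕ) (x : X) : tent s n x = max 0 (1 - n * dist x s) := rfl

theorem tent_self (s : X) (n : ℕ) : tent s n s = 1 := by simp [tent_apply]

theorem tent_nonneg (s : X) (n : ℕ) (x : X) : 0 ≤ tent s n x := le_max_left _ _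

theorem tent_le_one (s : X) (n : ℕ) (x : X) : tent s n x ≤ 1 :=
  max_le zero_le_one (sub_le_self _ (by positivity))

theorem antitone_tent_apply (s x : X) : Antitone fun n => tent s n x := by
  intro n m hnm
  simp only [tent_apply]
  gcongr

theorem eventually_tent_eq_zero {s : X} {U : Set X} (hU : U ∈ 𝓝 s) :
    ∀ᶠ n in atTop, ∀ x ∉ U, tent s n x = 0 := by
  obtain ⟨ε, hε, hball⟩ := Metric.mem_nhds_iff.1 hU
  obtain ⟨N, hN⟩ := exists_nat_gt (1 / ε)
  filter_upwards [eventually_ge_atTop N] with n hn x hx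
  have hdist : ε ≤ dist x s := not_lt.1 fun h => hx (hball h)
  refine max_eq_left (sub_nonpos.2 ?_)
  calc 1 = 1 / ε * ε := (one_div_mul_cancel hε.ne').symm
    _ ≤ n * dist x s := by gcongr; exact hN.le.trans (mod_cast hn)

theorem sum_abs_tent_sub_tent_le_one (s x : X) {a b : ℕ → ℕ} (hab : ∀ k, a k ≤ b k)
    (hba : ∀ k, b k ≤ a (k + 1)) (N : ℕ) :
    ∑ k ∈ Finset.range N, |tent s (a k) x - tent s (b k) x| ≤ 1 := by
  calc ∑ k ∈ Finset.range N, |tent s (a k) x - tent s (b k) x|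
      ≤ ∑ k ∈ Finset.range N, (tent s (a k) x - tent s (a (k + 1)) x) := by
        refine Finset.sum_le_sum fun k _ => ?_
        rw [abs_of_nonneg (sub_nonneg.2 (antitone_tent_apply s x (hab k)))]
        exact sub_le_sub_left (antitone_tent_apply s x (hba k)) _
    _ = tent s (a 0) x - tent s (a N) x :=
        Finset.sum_range_sub' (fun k => tent s (a k) x) N
    _ ≤ 1 := by linarith [tent_le_one s (a 0) x, tent_nonneg s (a N) x]

end Tent

variable {X : Type*} [PseudoMetricSpace X] [CompactSpace X]

/-- The atoms of mass at least `δ` of the measure representing `ν`; the mass of the point `s` is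
the limit of `ν (tent s n)`. -/
def largeAtoms (ν : C(X, ℝ) →L[ℝ] ℝ) (δ : ℝ) : Set X :=
  {s | ∃ᶠ n in atTop, δ ≤ |ν (tent s n)|}

theorem norm_tent_le_one (s : X) (n : ℕ) : ‖tent s n‖ ≤ 1 :=
  (ContinuousMap.norm_le _ zero_le_one).2 fun x => by
    rw [Real.norm_of_nonneg (tent_nonneg s n x)]
    exact tent_le_one s n x

theorem mem_largeAtoms_of_norm_sub_le {ν μ : C(X, ℝ) →L[ℝ] ℝ} {s : X} {δ ε : ℝ}
    (hνμ : ‖ν - μ‖ ≤ ε) (hs : s ∈ largeAtoms μ (δ + ε)) : s ∈ largeAtoms ν δ := by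
  refine hs.mono fun n hn => ?_
  have hdiff : |ν (tent s n) - μ (tent s n)| ≤ ε :=
    ((ν - μ).le_of_opNorm_le_of_le hνμ (norm_tent_le_one s n)).trans_eq (mul_one ε)
  linarith [abs_sub_abs_le_abs_sub (μ (tent s n)) (ν (tent s n)),
    abs_sub_comm (μ (tent s n)) (ν (tent s n))]

theorem sum_abs_le_one_of_pairwiseDisjoint {α ι : Type*} {T : Finset ι} {U : ι → Set α}
    (hU : (T : Set ι).PairwiseDisjoint U) {g : ι → α → ℝ} {x : α}
    (hgU : ∀ i ∈ T, x ∉ U i → g i x = 0) (hg : ∀ i ∈ T, |g i x| ≤ 1) :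
    ∑ i ∈ T, |g i x| ≤ 1 := by
  by_cases h : ∃ i ∈ T, x ∈ U i
  · obtain ⟨i, hi, hxi⟩ := h
    rw [Finset.sum_eq_single_of_mem i hi]
    · exact hg i hi
    · intro j hj hji
      rw [hgU j hj fun hxj => disjoint_left.1 (hU hj hi hji) hxj hxi, abs_zero]
  · push Not at h
    rw [Finset.sum_eq_zero fun i hi => by rw [hgU i hi (h i hi), abs_zero]]
    exact zero_le_one

theorem finite_largeAtoms {X : Type*} [MetricSpace X] [CompactSpace X] (ν : C(X, ℝ) →L[ℝ] ℝ)
    {δ : ℝ} (hδ : 0 < δ) : (largeAtoms ν δ).Finite := by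
  by_contra hinf
  obtain ⟨N, hN⟩ := exists_nat_gt (‖ν‖ / δ)
  obtain ⟨T, hT, hTN⟩ := Set.Infinite.exists_subset_card_eq hinf N
  obtain ⟨U, hU, hUdisj⟩ := T.finite_toSet.t2_separation
  have hex (s : X) (hs : s ∈ T) : ∃ n, δ ≤ |ν (tent s n)| ∧ ∀ x ∉ U s, tent s n x = 0 :=
    ((hT hs).and_eventually (eventually_tent_eq_zero ((hU s).2.mem_nhds (hU s).1))).exists
  choose! n hnδ hnU using hex
  have hsum : ‖∑ s ∈ T, |tent s (n s)|‖ ≤ 1 := by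
    refine (ContinuousMap.norm_le _ zero_le_one).2 fun x => ?_
    simp only [ContinuousMap.sum_apply, ContinuousMap.abs_apply]
    rw [Real.norm_of_nonneg (Finset.sum_nonneg fun s _ => abs_nonneg _)]
    exact sum_abs_le_one_of_pairwiseDisjoint hUdisj (fun s hs => hnU s hs x) fun s _ =>
      ((tent s (n s)).norm_coe_le_norm x).trans (norm_tent_le_one s (n s))
  refine hN.not_ge ((le_div_iff₀ hδ).2 ?_)
  calc N * δ = T.card • δ := by rw [hTN, nsmul_eq_mul]
    _ ≤ ∑ s ∈ T, |ν (tent s (n s))| := Finset.card_nsmul_le_sum _ _ _ hnδ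
    _ ≤ ‖ν‖ * ‖∑ s ∈ T, |tent s (n s)|‖ := sum_abs_apply_le_norm_mul ν T _
    _ ≤ ‖ν‖ := mul_le_of_le_one_right (norm_nonneg ν) hsum

end Atoms

section DualDirac

variable {K : Type*} [TopologicalSpace K]

section NormedSpace

variable {E : Type*} [NormedAddCommGroup E] [NormedSpace ℝ E]

/-- The functional `J* δ_t`, the image of the Dirac measure at `t` under the adjoint of `J`. -/
def dualDirac (J : E →L[ℝ] C(K, ℝ)) (t : K) : E →L[ℝ] ℝ := (ContinuousMap.evalCLM ℝ t).comp J

theorem norm_dualDirac_le [CompactSpace K] (J : E →L[ℝ] C(K, ℝ)) (t : K) :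
    ‖dualDirac J t‖ ≤ ‖J‖ :=
  (dualDirac J t).opNorm_le_bound (norm_nonneg J) fun x =>
    ((J x).norm_coe_le_norm t).trans (J.le_opNorm x)

theorem lowerSemicontinuous_norm_dualDirac_sub (J : E →L[ℝ] C(K, ℝ)) :
    LowerSemicontinuous fun p : K × K => ‖dualDirac J p.1 - dualDirac J p.2‖ := by
  intro p r hr
  obtain ⟨x, hx, hrx⟩ := ContinuousLinearMap.exists_lt_apply_of_lt_opNorm _ hr
  have hcont : Continuous fun q : K × K => ‖J x q.1 - J x q.2‖ := by fun_prop
  filter_upwards [hcont.continuousAt.eventually (eventually_gt_nhds hrx)] with q hq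
  exact hq.trans_le ((dualDirac J q.1 - dualDirac J q.2).unit_le_opNorm x hx.le)

end NormedSpace

variable [CompactSpace K]

theorem exists_blocks_of_frequently_mem {U : ℕ → Set K} (hU : ∀ n, IsOpen (U n))
    (hfreq : ∀ t, ∃ᶠ n in atTop, t ∈ U n) :
    ∃ a : ℕ → ℕ, ∀ k t, ∃ n ∈ Icc (a k) (a (k + 1)), t ∈ U n := by
  have hnext (n : ℕ) : ∃ N, ∀ t, ∃ m ∈ Icc n N, t ∈ U m := by
    have hmono : Monotone fun k => ⋃ m ∈ Icc n (n + k), U m := fun i j hij =>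
      biUnion_subset_biUnion_left (Icc_subset_Icc_right (by omega))
    have hcover : univ ⊆ ⋃ k, ⋃ m ∈ Icc n (n + k), U m := fun t _ => by
      obtain ⟨m, hnm, hm⟩ := frequently_atTop.1 (hfreq t) n
      exact mem_iUnion.2 ⟨m, mem_biUnion ⟨hnm, Nat.le_add_left m n⟩ hm⟩
    obtain ⟨k, hk⟩ := isCompact_univ.elim_directed_cover _
      (fun k => isOpen_biUnion fun m _ => hU m) hcover hmono.directed_le
    exact ⟨n + k, fun t => by simpa using hk (mem_univ t)⟩
  choose next hnext using hnext
  let a : ℕ → ℕ := Nat.rec 0 fun _ => next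
  exact ⟨a, fun k => hnext (a k)⟩

theorem norm_apply_sum_tent_le {X : Type*} [PseudoMetricSpace X] [CompactSpace X]
    (J : C(X, ℝ) →L[ℝ] C(K, ℝ)) {s : X} {δ : ℝ} (hδ : 0 ≤ δ) {a : ℕ → ℕ}
    (ha : ∀ k t, ∃ n ∈ Icc (a k) (a (k + 1)), |J (tent s n) t| ≤ δ) (N : ℕ) :
    ‖J (∑ k ∈ Finset.range N, tent s (a k))‖ ≤ ‖J‖ + N * δ := by
  refine (ContinuousMap.norm_le _ (by positivity)).2 fun t => ?_
  choose b hb hbδ using fun k => ha k t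
  let ν := dualDirac J t
  -- The differences telescope, so replacing every `a k` by `b k` costs `‖ν‖`, not `N * ‖ν‖`.
  have hsum : ‖∑ k ∈ Finset.range N, |tent s (a k) - tent s (b k)|‖ ≤ 1 := by
    refine (ContinuousMap.norm_le _ zero_le_one).2 fun x => ?_
    simp only [ContinuousMap.sum_apply, ContinuousMap.abs_apply]
    rw [Real.norm_of_nonneg (Finset.sum_nonneg fun k _ => abs_nonneg _)]
    exact sum_abs_tent_sub_tent_le_one s x (fun k => (hb k).1) (fun k => (hb k).2) N
  calc |ν (∑ k ∈ Finset.range N, tent s (a k))|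
      = |∑ k ∈ Finset.range N, (ν (tent s (a k) - tent s (b k)) + ν (tent s (b k)))| := by
        simp only [map_sum, map_sub, sub_add_cancel]
    _ ≤ ∑ k ∈ Finset.range N, (|ν (tent s (a k) - tent s (b k))| + |ν (tent s (b k))|) :=
        (Finset.abs_sum_le_sum_abs _ _).trans (Finset.sum_le_sum fun k _ => abs_add_le _ _)
    _ = ∑ k ∈ Finset.range N, |ν (tent s (a k) - tent s (b k))| +
          ∑ k ∈ Finset.range N, |ν (tent s (b k))| := Finset.sum_add_distrib
    _ ≤ ‖ν‖ * ‖∑ k ∈ Finset.range N, |tent s (a k) - tent s (b k)|‖ +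
          ∑ _ ∈ Finset.range N, δ :=
        add_le_add (sum_abs_apply_le_norm_mul ν _ _) (Finset.sum_le_sum fun k _ => hbδ k)
    _ ≤ ‖J‖ + N * δ := by
        rw [Finset.sum_const, Finset.card_range, nsmul_eq_mul]
        gcongr
        exact (mul_le_of_le_one_right (norm_nonneg ν) hsum).trans (norm_dualDirac_le J t)

theorem exists_mem_largeAtoms_dualDirac {X : Type*} [PseudoMetricSpace X] [CompactSpace X]
    (J : C(X, ℝ) →L[ℝ] C(K, ℝ)) {c δ : ℝ} (hJ : ∀ f, c * ‖f‖ ≤ ‖J f‖) (hδ : 0 ≤ δ)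
    (hδc : δ < c) (s : X) : ∃ t, s ∈ largeAtoms (dualDirac J t) δ := by
  by_contra! hatom
  obtain ⟨a, ha⟩ := exists_blocks_of_frequently_mem
    (U := fun n => {t | |J (tent s n) t| < δ}) (fun n => isOpen_lt (by fun_prop) continuous_const)
    fun t => ((not_frequently.1 (hatom t)).mono fun n hn => not_le.1 hn).frequently
  obtain ⟨N, hN⟩ := exists_nat_gt (‖J‖ / (c - δ))
  have hnorm : N ≤ ‖∑ k ∈ Finset.range N, tent s (a k)‖ :=
    calc (N : ℝ) = (∑ k ∈ Finset.range N, tent s (a k)) s := by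
          simp [ContinuousMap.sum_apply, tent_self]
      _ ≤ ‖∑ k ∈ Finset.range N, tent s (a k)‖ := (le_abs_self _).trans
          (ContinuousMap.norm_coe_le_norm (∑ k ∈ Finset.range N, tent s (a k)) s)
  have hupper : c * N ≤ ‖J‖ + N * δ :=
    calc c * N ≤ c * ‖∑ k ∈ Finset.range N, tent s (a k)‖ := by
          gcongr
          exact hδ.trans hδc.le
      _ ≤ ‖J (∑ k ∈ Finset.range N, tent s (a k))‖ := hJ _
      _ ≤ ‖J‖ + N * δ := norm_apply_sum_tent_le J hδ
          (fun k t => (ha k t).imp fun n hn => ⟨hn.1, hn.2.le⟩) N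
  rw [div_lt_iff₀ (sub_pos.2 hδc)] at hN
  linarith

theorem exists_uncountable_dualDirac_separated {X : Type*} [MetricSpace X] [CompactSpace X]
    [Uncountable X] (J : C(X, ℝ) →L[ℝ] C(K, ℝ)) {c : ℝ} (hc : 0 < c)
    (hJ : ∀ f, c * ‖f‖ ≤ ‖J f‖) :
    ∃ A : Set K, ¬ A.Countable ∧
      ∀ a ∈ A, {b ∈ A | ‖dualDirac J a - dualDirac J b‖ ≤ c / 4}.Finite := by
  choose t ht using exists_mem_largeAtoms_dualDirac J hJ (half_pos hc).le (half_lt_self hc)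
  refine ⟨range t, fun hcount => ?_, fun a _ => ?_⟩
  · have hcover : univ ⊆ ⋃ a ∈ range t, largeAtoms (dualDirac J a) (c / 2) :=
      fun s _ => mem_biUnion (mem_range_self s) (ht s)
    exact not_countable_univ ((hcount.biUnion fun a _ =>
      (finite_largeAtoms (dualDirac J a) (half_pos hc)).countable).mono hcover)
  · refine ((finite_largeAtoms (dualDirac J a) (by positivity : 0 < c / 4)).image t).subset ?_
    rintro _ ⟨⟨s, rfl⟩, hs⟩
    have hsum : c / 4 + c / 4 = c / 2 := by ring
    exact mem_image_of_mem t (mem_largeAtoms_of_norm_sub_le hs (hsum ▸ ht s))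

end DualDirac

namespace LscMetric

section Basic

variable {K : Type*} [TopologicalSpace K] (m : LscMetric K)

theorem d_nonneg (x y : K) : 0 ≤ m.d x y := by
  have h := m.d_triangle x y x
  rw [m.d_self, m.d_comm y x] at h
  linarith

theorem isClosed_setOf_d_le (p : K) (r : ℝ) : IsClosed {x | m.d p x ≤ r} :=
  (m.lsc.comp (g := fun x => (p, x)) (by fun_prop)).isClosed_preimage r

theorem exists_uncountable_inter_setOf_d_le {A : Set K} (hA : ¬ A.Countable) (p : K) :
    ∃ r, ¬ (A ∩ {x | m.d p x ≤ r}).Countable := by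
  by_contra! hcount
  refine hA ((countable_iUnion fun N : ℕ => hcount N).mono fun x hx => ?_)
  obtain ⟨N, hN⟩ := exists_nat_ge (m.d p x)
  exact mem_iUnion.2 ⟨N, hx, hN⟩

theorem discrete_d_of_ne [T2Space K] {x y : K} (h : x ≠ y) : (discrete K).d x y = 1 :=
  if_neg h

theorem isLipschitzFun_discrete [T2Space K] {f : K → ℝ} {C : ℝ} (hf : ∀ x, |f x| ≤ C) :
    (discrete K).IsLipschitzFun f := by
  refine ⟨C + C, fun s t => ?_⟩
  rcases eq_or_ne s t with rfl | h
  · simp [d_self]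
  · rw [discrete_d_of_ne h, mul_one]
    exact (abs_sub _ _).trans (add_le_add (hf s) (hf t))

theorem equivalent_discrete_range [T2Space K] {Y : Type*} [TopologicalSpace Y] [CompactSpace Y]
    [T2Space Y] {f : Y → K} (hf : Continuous f) {a b : ℝ} (ha : 0 < a)
    (hlower : Pairwise fun x y => a ≤ m.d (f x) (f y)) (hupper : ∀ x y, m.d (f x) (f y) ≤ b) :
    (m.restrict (range f)).Equivalent (discrete Y) := by
  have hinj : Function.Injective f := by
    intro x y hxy
    by_contra hne
    have hle : a ≤ m.d (f x) (f y) := hlower hne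
    rw [hxy, m.d_self] at hle
    exact hle.not_gt ha
  let e : Y ≃ₜ range f := (hf.isClosedEmbedding hinj).isEmbedding.toHomeomorph
  refine ⟨e.symm, ⟨a⁻¹, e.surjective.forall₂.2 fun x y => ?_⟩, b, fun x y => ?_⟩
  · rw [e.symm_apply_apply, e.symm_apply_apply]
    change _ ≤ a⁻¹ * m.d (f x) (f y)
    rcases eq_or_ne x y with rfl | h
    · rw [d_self, d_self, mul_zero]
    · rw [discrete_d_of_ne h, ← div_eq_inv_mul, one_le_div ha]
      exact hlower h
  · change m.d (f x) (f y) ≤ _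
    rcases eq_or_ne x y with rfl | h
    · rw [d_self, d_self, mul_zero]
    · rw [discrete_d_of_ne h, mul_one]
      exact hupper x y

theorem exists_norm_dualDirac_sub_le {E : Type*} [NormedAddCommGroup E] [NormedSpace ℝ E]
    [CompleteSpace E] (J : E →L[ℝ] C(K, ℝ)) (hJ : ∀ x, m.IsLipschitzFun (J x)) :
    ∃ L > 0, ∀ s t, ‖dualDirac J s - dualDirac J t‖ ≤ L * m.d s t := by
  let g : K × K → E →L[ℝ] ℝ := fun p => (m.d p.1 p.2)⁻¹ • (dualDirac J p.1 - dualDirac J p.2)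
  have hpointwise (x : E) : ∃ C, ∀ p, ‖g p x‖ ≤ C := by
    obtain ⟨L, hL⟩ := hJ x
    refine ⟨|L|, fun p => ?_⟩
    change ‖(m.d p.1 p.2)⁻¹ * (J x p.1 - J x p.2)‖ ≤ |L|
    rw [norm_mul, norm_inv, Real.norm_of_nonneg (m.d_nonneg _ _)]
    refine inv_mul_le_of_le_mul₀ (m.d_nonneg _ _) (abs_nonneg L) ((hL _ _).trans ?_)
    rw [mul_comm (m.d _ _)]
    exact mul_le_mul_of_nonneg_right (le_abs_self L) (m.d_nonneg _ _)
  obtain ⟨C, hC⟩ := banach_steinhaus hpointwise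
  refine ⟨max C 1, by positivity, fun s t => ?_⟩
  rcases (m.d_nonneg s t).eq_or_lt' with h | h
  · rw [m.eq_of_d_eq_zero s t h, sub_self, norm_zero, m.d_self, mul_zero]
  · have hquot : (m.d s t)⁻¹ * ‖dualDirac J s - dualDirac J t‖ ≤ C := by
      simpa only [g, norm_smul, norm_inv, Real.norm_of_nonneg h.le] using hC (s, t)
    rw [← div_le_iff₀ h, div_eq_inv_mul]
    exact hquot.trans (le_max_left C 1)

end Basic

theorem ContainsIsomorphicLipschitzCopy.exists_equivalent_cantorMetric {K : Type*}
    [TopologicalSpace K] [CompactSpace K] [MetrizableSpace K]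
    {m : LscMetric K} {X : Type*} [TopologicalSpace X] [CompactSpace X] [MetrizableSpace X]
    [Uncountable X] (h : m.ContainsIsomorphicLipschitzCopy C(X, ℝ)) :
    ∃ H : Set K, (m.restrict H).Equivalent cantorMetric := by
  let := metrizableSpaceMetric K
  let := metrizableSpaceMetric X
  obtain ⟨J, ⟨c, hc, hJ⟩, hlip⟩ := h
  obtain ⟨L, hL, hJL⟩ := m.exists_norm_dualDirac_sub_le J hlip
  obtain ⟨A, hA, hAfin⟩ := exists_uncountable_dualDirac_separated J hc hJ
  obtain ⟨p, -⟩ : A.Nonempty := nonempty_iff_ne_empty.2 fun h => hA (h ▸ countable_empty)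
  obtain ⟨r, hAr⟩ := m.exists_uncountable_inter_setOf_d_le hA p
  let R : K → K → Prop := fun a b => c / 4 < ‖dualDirac J a - dualDirac J b‖
  have : Std.Symm R := ⟨fun a b hab => hab.trans_eq (norm_sub_rev _ _)⟩
  obtain ⟨f, hf, hfA, hfR⟩ := exists_continuous_cantor_pairwise (R := R)
    ((lowerSemicontinuous_norm_dualDirac_sub J).isOpen_preimage (c / 4)) hAr
    fun a ha => ((hAfin a ha.1).subset fun b hb => ⟨hb.1.1, not_lt.1 hb.2⟩).countable
  have hball (x : CantorSpace) : m.d p (f x) ≤ r :=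
    closure_minimal inter_subset_right (m.isClosed_setOf_d_le p r) (hfA x)
  refine ⟨range f, m.equivalent_discrete_range hf (a := c / 4 / L) (b := r + r) (by positivity)
    (fun x y hxy => ?_) fun x y => ?_⟩
  · exact (div_le_iff₀' hL).2 ((hfR hxy).le.trans (hJL _ _))
  · calc m.d (f x) (f y) ≤ m.d p (f x) + m.d p (f y) :=
          m.d_comm p (f x) ▸ m.d_triangle (f x) p (f y)
      _ ≤ r + r := add_le_add (hball x) (hball y)

end LscMetric

section BanachMazur

variable {𝕜 X : Type*} [RCLike 𝕜] [NormedAddCommGroup X] [NormedSpace 𝕜 X]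

theorem exists_continuous_cantor_range_eq_dualUnitBall [SeparableSpace X] :
    ∃ q : CantorSpace → WeakDual 𝕜 X, Continuous q ∧
      range q = WeakDual.toStrongDual ⁻¹' Metric.closedBall 0 1 := by
  let B : Set (WeakDual 𝕜 X) := WeakDual.toStrongDual ⁻¹' Metric.closedBall 0 1
  have hB : IsCompact B := WeakDual.isCompact_closedBall 0 1
  have : CompactSpace B := isCompact_iff_compactSpace.1 hB
  have : MetrizableSpace B := WeakDual.metrizable_of_isCompact 𝕜 X B hB
  let := metrizableSpaceMetric B
  have : Nonempty B := ⟨⟨0, by simp [B]⟩⟩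
  obtain ⟨q, hq, hsurj⟩ := exists_nat_bool_continuous_surjective_of_compact B
  refine ⟨Subtype.val ∘ q, continuous_subtype_val.comp hq, ?_⟩
  rw [hsurj.range_comp, Subtype.range_coe]

theorem norm_eq_of_range_eq_dualUnitBall {K : Type*} [TopologicalSpace K] [CompactSpace K]
    {q : K → WeakDual 𝕜 X} (hq : range q = WeakDual.toStrongDual ⁻¹' Metric.closedBall 0 1)
    {x : X} {f : C(K, 𝕜)} (hf : ∀ s, f s = q s x) : ‖f‖ = ‖x‖ := by
  refine le_antisymm ((f.norm_le (norm_nonneg x)).2 fun s => ?_) ?_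
  · have hs : ‖WeakDual.toStrongDual (q s)‖ ≤ 1 :=
      mem_closedBall_zero_iff.1 (hq.subset (mem_range_self s))
    rw [hf]
    exact ((WeakDual.toStrongDual (q s)).le_of_opNorm_le hs x).trans_eq (one_mul _)
  · obtain ⟨g, hg, hgx⟩ := exists_dual_vector'' 𝕜 x
    obtain ⟨s, hs⟩ : StrongDual.toWeakDual g ∈ range q := hq.superset (by simpa using hg)
    calc ‖x‖ = ‖f s‖ := by
          rw [hf, hs]
          change _ = ‖g x‖
          rw [hgx, RCLike.norm_ofReal, abs_norm]
      _ ≤ ‖f‖ := f.norm_coe_le_norm s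

variable (𝕜 X) in
theorem exists_linearIsometry_continuousMap_cantorSpace [SeparableSpace X] :
    Nonempty (X →ₗᵢ[𝕜] C(CantorSpace, 𝕜)) := by
  obtain ⟨q, hq, hrange⟩ := exists_continuous_cantor_range_eq_dualUnitBall (𝕜 := 𝕜) (X := X)
  let J : X →ₗ[𝕜] C(CantorSpace, 𝕜) :=
    { toFun := fun x => ⟨fun s => q s x, (WeakDual.eval_continuous x).comp hq⟩
      map_add' := fun x y => ContinuousMap.ext fun s => map_add (q s) x y
      map_smul' := fun a x => ContinuousMap.ext fun s => map_smul (q s) a x }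
  exact ⟨⟨J, fun _ => norm_eq_of_range_eq_dualUnitBall hrange fun _ => rfl⟩⟩

end BanachMazur

theorem containsIsometricLipschitzCopy_cantorMetric (X : Type*) [NormedAddCommGroup X]
    [NormedSpace ℝ X] [SeparableSpace X] : cantorMetric.ContainsIsometricLipschitzCopy X := by
  obtain ⟨J⟩ := exists_linearIsometry_continuousMap_cantorSpace ℝ X
  exact ⟨J, fun x => LscMetric.isLipschitzFun_discrete (J x).norm_coe_le_norm⟩

instance uncountable_cantorSpace : Uncountable CantorSpace := by
  rw [← Cardinal.aleph0_lt_mk_iff]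
  simpa using Cardinal.cantor Cardinal.aleph0

instance metrizableSpace_ulift {X : Type*} [TopologicalSpace X] [MetrizableSpace X] :
    MetrizableSpace (ULift X) :=
  Homeomorph.ulift.isEmbedding.metrizableSpace

theorem proposition5p9_general :
    (∀ (X : Type u) [NormedAddCommGroup X] [NormedSpace ℝ X] [SeparableSpace X],
      cantorMetric.ContainsIsometricLipschitzCopy X) ∧
    ∀ (K : Type v) [TopologicalSpace K] [CompactSpace K] [MetrizableSpace K] (m : LscMetric K)
      (X : Type*) [TopologicalSpace X] [CompactSpace X] [MetrizableSpace X] [Uncountable X],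
      m.ContainsIsomorphicLipschitzCopy C(X, ℝ) →
      ∃ H : Set K, LscMetric.Equivalent (m.restrict H) cantorMetric :=
  ⟨fun X _ _ _ => containsIsometricLipschitzCopy_cantorMetric X,
    fun _ _ _ _ _ _ _ _ _ _ h => h.exists_equivalent_cantorMetric⟩

theorem proposition5p9 :
    LscMetric.IsometricLipschitzUniversal.{u} cantorMetric ∧
    ∀ (K : Type v) [TopologicalSpace K] [CompactSpace K] [TopologicalSpace.MetrizableSpace K]
      (m : LscMetric K), LscMetric.IsomorphicLipschitzUniversal.{u} m →
      ∃ H : Set K, LscMetric.Equivalent (m.restrict H) cantorMetric :=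
  ⟨fun X _ _ _ _ => proposition5p9_general.{u, v, u}.1 X, fun K _ _ _ m hm =>
    proposition5p9_general.{u, v, u}.2 K m (ULift CantorSpace) (hm C(ULift CantorSpace, ℝ))⟩
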